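/- All graphs are finite and simple. A graph $H$ is a topological minor of a graph $G$ if some subdivision of $H$ (a graph obtained from $H$ by replacing its edges by pairwise internally disjoint paths) is a subgraph of $G$. Let $r\in\mathbb N$. A linear order on $V(G)$ is represented by an injective function $L\colon V(G)\to\mathbb N$. For $v\in V(G)$ let $\mathrm{WReach}_r[G,L,v]$ be the set of vertices $u$ for which there is a path $P$ of length at most $r$ from $v$ to $u$ with $L(u)\le L(w)$ for all $w\in V(P)$, and let $\mathrm{adm}_r[G,L,v]$ be the maximum size of a set of paths of length at most $r$ in $G$ that start in $v$, end in a vertex $w$ with $L(w)\le L(v)$, and pairwise have exactly the vertex $v$ in common (the path of length $0$ is allowed). Put $$\mathrm{wcol}_r(G)=\min_L\max_{v\in V(G)}|\mathrm{WReach}_r[G,L,v]|,\qquad \mathrm{adm}_r(G)=\min_L\max_{v\in V(G)}\mathrm{adm}_r[G,L,v],$$ where a maximum over the empty set is $0$. **Corollary.** Let $\mathcal C$ be a class of graphs that excludes some fixed graph $H$ as a topological minor, that is, $H$ is not a topological minor of any $G\in\mathcal C$. Then: 1. There is a constant $c$, depending only on $\mathcal C$, such that $\mathrm{adm}_r(G)\le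 c\,r$ for all $G\in\mathcal C$ and all integers $r\ge 1$. 2. For every $\varepsilon>0$ there is a constant $c$, depending only on $\mathcal C$ and $\varepsilon$, such that $\mathrm{wcol}_r(G)\le c\,r^{(1+\varepsilon)r}$ for all $G\in\mathcal C$ and all integers $r\ge1$. -/

import Mathlib

universe u v

namespace SimpleGraph

variable {V : Type u} {W : Type v}

/-- `H` is a topological minor of `G`: some subdivision of `H` is a subgraph of `G`. The vertices
of `H` are sent injectively to branch vertices of `G`, and every edge of `H` is replaced by a path
of `G` between the corresponding branch vertices (the two orientations of an edge give the same
path, traversed in opposite directions). No inner vertex of these paths is a branch vertex, and the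
paths belonging to different edges of `H` meet only in branch vertices. -/
def IsTopologicalMinor (H : SimpleGraph W) (G : SimpleGraph V) : Prop :=
  ∃ (b : W ↪ V) (p : ∀ d : H.Dart, G.Walk (b d.fst) (b d.snd)),
    (∀ d, (p d).IsPath) ∧
    (∀ d, p d.symm = (p d).reverse) ∧
    (∀ d w, b w ∈ (p d).support → w = d.fst ∨ w = d.snd) ∧
    (∀ d d', d.edge ≠ d'.edge → ∀ x, x ∈ (p d).support → x ∈ (p d').support → ∃ w, x = b w)

/-- The set of vertices that are weakly `r`-reachable from `x` with respect to the linear order on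
the vertices that is represented by the injective function `L`. -/
def wReach (G : SimpleGraph V) (L : V ↪ ℕ) (r : ℕ) (x : V) : Set V :=
  {y | ∃ P : G.Walk x y, P.IsPath ∧ P.length ≤ r ∧ ∀ w ∈ P.support, L y ≤ L w}

/-- The weak `r`-colouring number of a finite graph: the minimum over all linear orders of the
maximum size of a set of weakly `r`-reachable vertices (the maximum over no vertices is `0`). -/
noncomputable def wcol (G : SimpleGraph V) (r : ℕ) : ℕ :=
  ⨅ L : V ↪ ℕ, ⨆ x : V, (G.wReach L r x).ncard

/-- `F` is a family of paths of length at most `r` that start in `x`, end in a vertex that is at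
most `x` in the order, and pairwise meet exactly in `x`. The path of length `0` is allowed. -/
def IsAdmFamily (G : SimpleGraph V) (L : V ↪ ℕ) (r : ℕ) (x : V)
    (F : Finset (Σ y : V, G.Path x y)) : Prop :=
  (∀ P ∈ F, (P.2 : G.Walk x P.1).length ≤ r ∧ L P.1 ≤ L x) ∧
  ∀ P ∈ F, ∀ Q ∈ F, P ≠ Q →
    {z | z ∈ (P.2 : G.Walk x P.1).support} ∩ {z | z ∈ (Q.2 : G.Walk x Q.1).support} = {x}

/-- The `r`-admissibility of the vertex `x` with respect to `L`, that is, the maximum size of a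
family of paths as above. -/
noncomputable def admAt (G : SimpleGraph V) (L : V ↪ ℕ) (r : ℕ) (x : V) : ℕ :=
  sSup {k | ∃ F : Finset (Σ y : V, G.Path x y), G.IsAdmFamily L r x F ∧ F.card = k}

/-- The `r`-admissibility of a finite graph (the maximum over no vertices is `0`). -/
noncomputable def adm (G : SimpleGraph V) (r : ℕ) : ℕ :=
  ⨅ L : V ↪ ℕ, ⨆ x : V, G.admAt L r x

/-- In a finite graph the supremum in `admAt` is a maximum: the sizes in question are bounded by
the number of vertices. -/
theorem IsAdmFamily.card_le [Finite V] {G : SimpleGraph V} {L : V ↪ ℕ} {r : ℕ} {x : V}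
    {F : Finset (Σ y : V, G.Path x y)} (hF : G.IsAdmFamily L r x F) : F.card ≤ Nat.card V := by
  have := Fintype.ofFinite V
  rw [Nat.card_eq_fintype_card, ← Finset.card_univ]
  refine Finset.card_le_card_of_injOn Sigma.fst (fun _ _ => Finset.mem_coe.2 (Finset.mem_univ _)) ?_
  rintro ⟨y, P⟩ hP ⟨z, Q⟩ hQ (h : y = z)
  subst h
  by_contra hne
  have hy : y ∈ ({x} : Set V) := by
    rw [← hF.2 _ hP _ hQ hne]
    exact ⟨Walk.end_mem_support _, Walk.end_mem_support _⟩
  rw [Set.mem_singleton_iff] at hy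
  subst hy
  exact hne (by rw [Path.loop_eq P, Path.loop_eq Q])

end SimpleGraph

namespace SimpleGraph

section

open Finset
open scoped Classical

variable {V : Type u} {W : Type v}

/-! Both bounds come from one order, whose admissibility is linear in `r` with a factor depending
only on `H`.

By Mader's theorem (`hasModelIn_of_dartCount`) a graph of average degree at least `D`, a constant
depending on `H`, contains `H` topologically. If the edges of a graph `K` on a vertex set `A` of `G`
can be realised by paths of `G` with inner vertices outside `A` and disjoint for distinct edges, a
model of `H` in `K` expands to one in `G` (`HasModelIn.of_isLinkage`). Hence every such `K` is
sparse.

Suppose that every vertex of some `S` starts a large family of short paths into `S`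
(`exists_card_family_le`). Take a maximal linkage `K` on `S` with at most `2 * r` inner vertices per
edge. It is sparse, so a constant fraction `R` of `S` is independent in `K`, and adding all inner
vertices to `S` gives a set `A` of size `O(r * #S)`. Cut the paths that start in `R` at their first
return to `A`. Two cut paths from different vertices of `R` cannot meet outside `A`, since together
they would give a new edge of `K`. So they form a linkage on `A` whose edge number forces density
`D`, a contradiction. Removing vertices with few paths one by one yields the order.

For the weak colouring number, admissibility bounds the branching of a breadth-first search tree,
giving `k ^ s` strongly reachable smaller vertices (`card_strongReach_le`). Splitting a weak
reachability path at its first vertex below the start gives `(2 * k) ^ r`. With `k` linear in `r`,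
the exponential factor is absorbed by `r ^ (ε * r)`. -/

/-! ### Topological minor models and linkages -/

/-- A topological minor model of `H` in `G` inside the vertex set `A`, given by branch vertices and
by a set of potential inner vertices for every edge. -/
def HasModelIn (H : SimpleGraph W) (G : SimpleGraph V) (A : Set V) : Prop :=
  ∃ (b : W ↪ V) (I : Sym2 W → Set V),
    (∀ w, b w ∈ A) ∧ (∀ e, I e ⊆ A) ∧ (∀ e w, b w ∉ I e) ∧
    (∀ e ∈ H.edgeSet, ∀ e' ∈ H.edgeSet, e ≠ e' → Disjoint (I e) (I e')) ∧
    ∀ a c, H.Adj a c → ∃ p : G.Walk (b a) (b c),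
      ∀ x ∈ p.support, x = b a ∨ x = b c ∨ x ∈ I s(a, c)

theorem HasModelIn.mono {H : SimpleGraph W} {G : SimpleGraph V} {A B : Set V}
    (h : H.HasModelIn G A) (hAB : A ⊆ B) : H.HasModelIn G B := by
  obtain ⟨b, I, h1, h2, h3⟩ := h
  exact ⟨b, I, fun w => hAB (h1 w), fun e => (h2 e).trans hAB, h3⟩

theorem HasModelIn.isTopologicalMinor {H : SimpleGraph W} {G : SimpleGraph V} {A : Set V}
    (h : H.HasModelIn G A) : H.IsTopologicalMinor G := by
  obtain ⟨b, I, -, -, hbI, hI, hp⟩ := h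
  have hpath : ∀ a c, H.Adj a c → ∃ p : G.Walk (b a) (b c), p.IsPath ∧
      ∀ x ∈ p.support, x = b a ∨ x = b c ∨ x ∈ I s(a, c) := by
    intro a c hac
    obtain ⟨p, hp⟩ := hp a c hac
    exact ⟨p.bypass, p.bypass_isPath, fun x hx => hp x (p.support_bypass_subset_support hx)⟩
  choose q hq hqs using hpath
  -- The order on `W` selects one orientation of each edge, so that opposite darts get mutually
  -- reverse paths.
  let _ : LinearOrder W := linearOrderOfSTO WellOrderingRel
  let Q : ∀ a c, H.Adj a c → G.Walk (b a) (b c) := fun a c h =>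
    if a < c then q a c h else (q c a h.symm).reverse
  have hQp : ∀ a c h, (Q a c h).IsPath := by
    intro a c h
    simp only [Q]
    split_ifs
    · exact hq _ _ _
    · exact (hq _ _ _).reverse
  have hQs : ∀ a c h, ∀ x ∈ (Q a c h).support, x = b a ∨ x = b c ∨ x ∈ I s(a, c) := by
    intro a c h x hx
    simp only [Q] at hx
    split_ifs at hx
    · exact hqs _ _ _ x hx
    · rw [Walk.support_reverse, List.mem_reverse] at hx
      have := hqs _ _ _ x hx
      rw [Sym2.eq_swap]
      tauto
  have hQr : ∀ a c h, Q c a h.symm = (Q a c h).reverse := by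
    intro a c h
    rcases lt_trichotomy a c with hac | hac | hac
    · simp [Q, hac, not_lt_of_gt hac]
    · exact absurd hac h.ne
    · simp [Q, hac, not_lt_of_gt hac]
  refine ⟨b, fun d => Q d.fst d.snd d.adj, fun d => hQp _ _ _, fun d => hQr _ _ _, ?_, ?_⟩
  · intro d w hw
    rcases hQs _ _ _ _ hw with h | h | h
    · exact Or.inl (b.injective h)
    · exact Or.inr (b.injective h)
    · exact absurd h (hbI _ _)
  · intro d d' hdd x hx hx'
    rcases hQs _ _ _ _ hx with h | h | h
    · exact ⟨_, h⟩
    · exact ⟨_, h⟩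
    rcases hQs _ _ _ _ hx' with h' | h' | h'
    · exact ⟨_, h'⟩
    · exact ⟨_, h'⟩
    exact absurd h' (Set.disjoint_left.1 (hI _ d.edge_mem _ d'.edge_mem hdd) h)

/-- `J` assigns pairwise disjoint sets of vertices outside `A` to the edges of `K`, which lie in
`A`, so that every edge can be replaced by a path of `G` through its set. -/
def IsLinkage (G K : SimpleGraph V) (A : Set V) (J : Sym2 V → Set V) : Prop :=
  (∀ a c, K.Adj a c → a ∈ A) ∧ (∀ e, Disjoint (J e) A) ∧
  (∀ e ∈ K.edgeSet, ∀ e' ∈ K.edgeSet, e ≠ e' → Disjoint (J e) (J e')) ∧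
  ∀ a c, K.Adj a c → ∃ p : G.Walk a c, ∀ x ∈ p.support, x = a ∨ x = c ∨ x ∈ J s(a, c)

theorem IsLinkage.exists_walk {G K : SimpleGraph V} {A : Set V} {J : Sym2 V → Set V}
    (h : G.IsLinkage K A J) (B : Set V) {a c : V} (p : K.Walk a c) (hp : ∀ x ∈ p.support, x ∈ B) :
    ∃ q : G.Walk a c, ∀ x ∈ q.support,
      x ∈ B ∨ ∃ f ∈ K.edgeSet, (∀ y ∈ f, y ∈ B) ∧ x ∈ J f := by
  induction p with
  | nil => exact ⟨Walk.nil, fun x hx => Or.inl (hp x (by simpa using hx))⟩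
  | @cons a d c hd p ih =>
    obtain ⟨q, hq⟩ := ih (fun x hx => hp x (by simp [hx]))
    obtain ⟨q', hq'⟩ := h.2.2.2 _ _ hd
    have ha : a ∈ B := hp a (by simp)
    have hdB : d ∈ B := hp d (by simp)
    refine ⟨q'.append q, fun x hx => ?_⟩
    rw [Walk.mem_support_append_iff] at hx
    rcases hx with hx | hx
    · rcases hq' x hx with rfl | rfl | hx
      · exact Or.inl ha
      · exact Or.inl hdB
      · refine Or.inr ⟨s(a, d), hd, ?_, hx⟩
        intro y hy
        rcases Sym2.mem_iff.1 hy with rfl | rfl <;> assumption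
    · exact hq x hx

theorem HasModelIn.of_isLinkage {H : SimpleGraph W} {G K : SimpleGraph V} {A : Set V}
    {J : Sym2 V → Set V} (hH : H.HasModelIn K A) (h : G.IsLinkage K A J) :
    H.HasModelIn G Set.univ := by
  obtain ⟨b, I, hbA, hIA, hbI, hI, hp⟩ := hH
  set B : Sym2 W → Set V := fun e => {x | (∃ w ∈ e, x = b w) ∨ x ∈ I e} with hB
  have hBA : ∀ e, B e ⊆ A := by
    rintro e x (⟨w, -, rfl⟩ | hx)
    · exact hbA w
    · exact hIA _ hx
  refine ⟨b, fun e => I e ∪ {x | ∃ f ∈ K.edgeSet, (∀ y ∈ f, y ∈ B e) ∧ x ∈ J f},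
    fun _ => trivial, fun _ _ _ => trivial, ?_, ?_, ?_⟩
  · rintro e w (hw | ⟨f, -, -, hw⟩)
    · exact hbI _ _ hw
    · exact Set.disjoint_left.1 (h.2.1 f) hw (hbA w)
  · intro e he e' he' hne
    rw [Set.disjoint_left]
    rintro x (hx | ⟨f, hf, hfB, hx⟩) (hx' | ⟨f', hf', hfB', hx'⟩)
    · exact Set.disjoint_left.1 (hI e he e' he' hne) hx hx'
    · exact Set.disjoint_left.1 (h.2.1 f') hx' (hIA _ hx)
    · exact Set.disjoint_left.1 (h.2.1 f) hx (hIA _ hx')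
    · have hff : f = f' := by
        by_contra hff
        exact Set.disjoint_left.1 (h.2.2.1 f hf f' hf' hff) hx hx'
      subst hff
      -- An edge `f` of `K` used for both `e` and `e'` has both ends in `B e ∩ B e'`, which contains
      -- only branch vertices of common ends. Two distinct common ends force `e = e'`.
      have key : ∀ y ∈ f, ∃ w, w ∈ e ∧ w ∈ e' ∧ y = b w := by
        intro y hy
        rcases hfB y hy with ⟨w, hw, rfl⟩ | hyI
        · rcases hfB' _ hy with ⟨w', hw', hww⟩ | hyI
          · rw [b.injective hww] at hw ⊢
            exact ⟨w', hw, hw', rfl⟩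
          · exact absurd hyI (hbI _ _)
        · rcases hfB' _ hy with ⟨w', hw', rfl⟩ | hyI'
          · exact absurd hyI (hbI _ _)
          · exact absurd hyI' (Set.disjoint_left.1 (hI e he e' he' hne) hyI)
      induction f with
      | _ y z =>
      obtain ⟨w, hwe, hwe', rfl⟩ := key y (Sym2.mem_mk_left _ _)
      obtain ⟨w', hwe2, hwe2', rfl⟩ := key z (Sym2.mem_mk_right _ _)
      have hww : w ≠ w' := by
        rintro rfl
        exact K.loopless.irrefl _ hf
      exact hne (((Sym2.mem_and_mem_iff hww).1 ⟨hwe, hwe2⟩).trans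
        ((Sym2.mem_and_mem_iff hww).1 ⟨hwe', hwe2'⟩).symm)
  · intro a c hac
    obtain ⟨p, hp⟩ := hp a c hac
    obtain ⟨q, hq⟩ := h.exists_walk (B s(a, c)) p (by
      intro x hx
      rcases hp x hx with h | h | h
      · exact Or.inl ⟨a, Sym2.mem_mk_left _ _, h⟩
      · exact Or.inl ⟨c, Sym2.mem_mk_right _ _, h⟩
      · exact Or.inr h)
    refine ⟨q, fun x hx => ?_⟩
    rcases hq x hx with (⟨w, hw, rfl⟩ | hx) | hx
    · rcases Sym2.mem_iff.1 hw with rfl | rfl <;> simp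
    · exact Or.inr (Or.inr (Or.inl hx))
    · exact Or.inr (Or.inr (Or.inr hx))

/-! ### Mader's theorem -/

/-- Twice the number of edges of `G` inside `A`. -/
noncomputable def dartCount (G : SimpleGraph V) (A : Finset V) : ℕ :=
  ∑ v ∈ A, #{w ∈ A | G.Adj v w}

theorem dartCount_eq_erase_add (G : SimpleGraph V) {A : Finset V} {v : V} (hv : v ∈ A) :
    G.dartCount A = G.dartCount (A.erase v) + 2 * #{w ∈ A | G.Adj v w} := by
  have h1 : ∀ u ∈ A.erase v, #{w ∈ A | G.Adj u w} =
      #{w ∈ A.erase v | G.Adj u w} + if G.Adj v u then 1 else 0 := by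
    intro u _
    conv_lhs => rw [← Finset.insert_erase hv, Finset.filter_insert]
    by_cases h : G.Adj v u
    · simp [h, h.symm]
    · have h' : ¬ G.Adj u v := fun h' => h h'.symm
      simp [h, h']
  have h2 : #{w ∈ A.erase v | G.Adj v w} = #{w ∈ A | G.Adj v w} := by
    congr 1
    ext w
    simp only [mem_filter, mem_erase]
    exact ⟨fun h => ⟨h.1.2, h.2⟩, fun h => ⟨⟨h.2.ne', h.1⟩, h.2⟩⟩
  unfold dartCount
  rw [← Finset.add_sum_erase A _ hv, Finset.sum_congr rfl h1, Finset.sum_add_distrib,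
    ← Finset.card_filter, h2]
  ring

/-- The neighbours in `A` of a set `U` that lie outside `U`. -/
noncomputable def nbhdIn (G : SimpleGraph V) (A U : Finset V) : Finset V :=
  {v ∈ A \ U | ∃ u ∈ U, G.Adj u v}

/-- The missing edge is routed through the connected set `U`, which every branch vertex sees and
which the given model, lying in `N`, does not touch. -/
theorem HasModelIn.of_deleteEdges {H : SimpleGraph W} {G : SimpleGraph V} {N U : Set V}
    (hNU : Disjoint N U) {e : Sym2 W}
    (hU : ∀ a ∈ U, ∀ c ∈ U, ∃ p : G.Walk a c, ∀ x ∈ p.support, x ∈ U)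
    (hN : ∀ v ∈ N, ∃ u ∈ U, G.Adj u v)
    (h : (H.deleteEdges {e}).HasModelIn G N) : H.HasModelIn G (N ∪ U) := by
  obtain ⟨b, I, hbN, hIN, hbI, hI, hp⟩ := h
  refine ⟨b, fun f => if f = e then U else I f, fun w => Or.inl (hbN w), ?_, ?_, ?_, ?_⟩
  · intro f
    dsimp only
    split_ifs
    · exact Set.subset_union_right
    · exact (hIN f).trans Set.subset_union_left
  · intro f w
    dsimp only
    split_ifs
    · exact Set.disjoint_left.1 hNU (hbN w)
    · exact hbI f w
  · intro f hf f' hf' hne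
    dsimp only
    split_ifs with h1 h2 h2
    · exact absurd (h1.trans h2.symm) hne
    · exact (hNU.mono_left (hIN f')).symm
    · exact hNU.mono_left (hIN f)
    · exact hI f (by simp [edgeSet_deleteEdges, hf, h1]) f'
        (by simp [edgeSet_deleteEdges, hf', h2]) hne
  · intro a c hac
    by_cases hace : s(a, c) = e
    · obtain ⟨u, hu, hua⟩ := hN _ (hbN a)
      obtain ⟨u', hu', huc⟩ := hN _ (hbN c)
      obtain ⟨p, hp⟩ := hU u hu u' hu'
      refine ⟨Walk.cons hua.symm (p.append (Walk.cons huc Walk.nil)), fun x hx => ?_⟩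
      simp only [hace, if_true]
      simp only [Walk.support_cons, List.mem_cons, Walk.mem_support_append_iff,
        Walk.support_nil, List.not_mem_nil, or_false] at hx
      rcases hx with hx | hx | hx | hx
      · exact Or.inl hx
      · exact Or.inr (Or.inr (hp x hx))
      · exact Or.inr (Or.inr (hx ▸ hu'))
      · exact Or.inr (Or.inl hx)
    · obtain ⟨p, hp⟩ := hp a c (by simp [deleteEdges_adj, hac, hace])
      exact ⟨p, fun x hx => by simpa [hace] using hp x hx⟩

/-- Contracting a connected set `U` that is maximal subject to the contracted graph having average
degree at least `2 * D` leaves minimum degree at least `D` in the neighbourhood of `U`. -/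
theorem exists_connected_nbhdIn (G : SimpleGraph V) {A : Finset V} (hA : A.Nonempty) {D : ℕ}
    (h : 2 * D * #A ≤ G.dartCount A) :
    ∃ U ⊆ A, U.Nonempty ∧ (∀ a ∈ U, ∀ c ∈ U, ∃ p : G.Walk a c, ∀ x ∈ p.support, x ∈ U) ∧
      2 * D * (#(A \ U) + 1) ≤ G.dartCount (A \ U) + 2 * #(G.nbhdIn A U) ∧
      ∀ v ∈ G.nbhdIn A U, D ≤ #{w ∈ G.nbhdIn A U | G.Adj v w} := by
  set P : Finset V → Prop := fun U => U.Nonempty ∧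
    (∀ a ∈ U, ∀ c ∈ U, ∃ p : G.Walk a c, ∀ x ∈ p.support, x ∈ U) ∧
    2 * D * (#(A \ U) + 1) ≤ G.dartCount (A \ U) + 2 * #(G.nbhdIn A U) with hP
  obtain ⟨v, hv⟩ := hA
  have hne : (A.powerset.filter P).Nonempty := by
    refine ⟨{v}, ?_⟩
    rw [Finset.mem_filter, Finset.mem_powerset, Finset.singleton_subset_iff]
    refine ⟨hv, Finset.singleton_nonempty v, ?_, ?_⟩
    · intro a ha c hc
      obtain rfl := Finset.mem_singleton.1 ha
      obtain rfl := Finset.mem_singleton.1 hc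
      exact ⟨Walk.nil, by simp⟩
    · have h1 : G.nbhdIn A {v} = {w ∈ A | G.Adj v w} := by
        ext w
        simp only [nbhdIn, mem_filter, mem_sdiff, mem_singleton, exists_eq_left]
        exact ⟨fun h => ⟨h.1.1, h.2⟩, fun h => ⟨⟨h.1, h.2.ne'⟩, h.2⟩⟩
      rw [h1, Finset.sdiff_singleton_eq_erase, ← G.dartCount_eq_erase_add hv,
        Finset.card_erase_add_one hv]
      exact h
  obtain ⟨U, hU, hmax⟩ := Finset.exists_max_image _ Finset.card hne
  rw [Finset.mem_filter, Finset.mem_powerset] at hU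
  obtain ⟨hUA, hUne, hUc, hUd⟩ := hU
  refine ⟨U, hUA, hUne, hUc, hUd, ?_⟩
  intro v hv
  have hv' := hv
  simp only [nbhdIn, mem_filter, mem_sdiff] at hv'
  obtain ⟨⟨hvA, hvU⟩, u, hu, huv⟩ := hv'
  have hnot : ¬ P (insert v U) := by
    intro hPv
    have := hmax (insert v U) (by
      rw [Finset.mem_filter, Finset.mem_powerset]
      exact ⟨Finset.insert_subset hvA hUA, hPv⟩)
    rw [Finset.card_insert_of_notMem hvU] at this
    omega
  have hconn : ∀ a ∈ insert v U, ∃ p : G.Walk a u, ∀ x ∈ p.support, x ∈ insert v U := by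
    intro a ha
    rcases Finset.mem_insert.1 ha with rfl | ha
    · exact ⟨Walk.cons huv.symm Walk.nil, by simp [hu]⟩
    · obtain ⟨p, hp⟩ := hUc a ha u hu
      exact ⟨p, fun x hx => Finset.mem_insert_of_mem (hp x hx)⟩
  -- Absorbing `v` costs one vertex and `1 + #{w ∈ G.nbhdIn A U | G.Adj v w}` edges of the
  -- contracted graph. By maximality this loss breaks the density bound, so it exceeds `D`.
  have hlt : G.dartCount (A \ insert v U) + 2 * #(G.nbhdIn A (insert v U)) <
      2 * D * (#(A \ insert v U) + 1) := by
    by_contra hge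
    refine hnot ⟨Finset.insert_nonempty _ _, ?_, not_lt.1 hge⟩
    intro a ha c hc
    obtain ⟨p, hp⟩ := hconn a ha
    obtain ⟨q, hq⟩ := hconn c hc
    refine ⟨p.append q.reverse, fun x hx => ?_⟩
    rw [Walk.mem_support_append_iff, Walk.support_reverse, List.mem_reverse] at hx
    exact hx.elim (hp x) (hq x)
  have hvm : v ∈ A \ U := Finset.mem_sdiff.2 ⟨hvA, hvU⟩
  have hAU : A \ insert v U = (A \ U).erase v := by
    ext w
    simp only [mem_sdiff, mem_insert, mem_erase]
    tauto
  rw [hAU, Finset.card_erase_add_one hvm] at hlt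
  have hdc := G.dartCount_eq_erase_add hvm
  have hsub : (G.nbhdIn A U).erase v ∪
      ({w ∈ A \ U | G.Adj v w} \ {w ∈ G.nbhdIn A U | G.Adj v w}) ⊆ G.nbhdIn A (insert v U) := by
    intro w hw
    simp only [nbhdIn, mem_union, mem_erase, mem_filter, mem_sdiff, mem_insert] at hw ⊢
    rcases hw with ⟨h1, ⟨h2, h3⟩, u', h4, h5⟩ | ⟨⟨⟨h1, h2⟩, h3⟩, -⟩
    · exact ⟨⟨h2, by tauto⟩, u', Or.inr h4, h5⟩
    · exact ⟨⟨h1, fun h => h.elim h3.ne' h2⟩, v, Or.inl rfl, h3⟩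
  have hdisj : Disjoint ((G.nbhdIn A U).erase v)
      ({w ∈ A \ U | G.Adj v w} \ {w ∈ G.nbhdIn A U | G.Adj v w}) := by
    rw [Finset.disjoint_left]
    intro w hw hw'
    simp only [mem_erase, mem_filter, mem_sdiff] at hw hw'
    tauto
  have hcard := Finset.card_le_card hsub
  rw [Finset.card_union_of_disjoint hdisj, Finset.card_sdiff_of_subset, Finset.card_erase_of_mem hv]
    at hcard
  · have hpos := Finset.card_pos.2 ⟨v, hv⟩
    have : 2 * D * (#(A \ U) + 1) = 2 * D * #(A \ U) + 2 * D := by ring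
    omega
  · exact Finset.filter_subset_filter _ (Finset.filter_subset _ _)

/-- **Mader's theorem**: a sufficiently dense graph contains a given graph as a topological
minor. -/
theorem hasModelIn_of_dartCount [Fintype W] (G : SimpleGraph V) (m : ℕ) :
    ∀ H : SimpleGraph W, H.edgeSet.ncard = m → ∀ A : Finset V, A.Nonempty →
      2 ^ m * (Fintype.card W + 1) * #A ≤ G.dartCount A → H.HasModelIn G A := by
  induction m with
  | zero =>
    intro H hH A hA h
    rw [Set.ncard_eq_zero (Set.toFinite _)] at hH
    have hcard : Fintype.card W ≤ #A := by
      by_contra hlt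
      have : G.dartCount A ≤ ∑ v ∈ A, #A :=
        Finset.sum_le_sum fun v _ => Finset.card_le_card (Finset.filter_subset _ _)
      rw [Finset.sum_const, smul_eq_mul] at this
      have hpos := hA.card_pos
      have := h.trans this
      rw [pow_zero, one_mul] at this
      have := Nat.le_of_mul_le_mul_right this hpos
      omega
    have : Fintype.card W ≤ Fintype.card A := by simpa using hcard
    obtain ⟨b⟩ := Function.Embedding.nonempty_of_card_le this
    refine ⟨b.trans (Function.Embedding.subtype _), fun _ => ∅, fun w => (b w).2, by simp, by simp,
      by simp, ?_⟩
    intro a c hac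
    have : s(a, c) ∈ H.edgeSet := hac
    simp [hH] at this
  | succ m ih =>
    intro H hH A
    induction A using Finset.strongInduction with
    | H A ihA =>
    intro hA h
    have hne : 0 < H.edgeSet.ncard := by omega
    obtain ⟨e, he⟩ := (Set.ncard_pos (Set.toFinite _)).1 hne
    have hHe : (H.deleteEdges {e}).edgeSet.ncard = m := by
      rw [edgeSet_deleteEdges, Set.ncard_sdiff_singleton_of_mem he, hH]
      rfl
    set D := 2 ^ m * (Fintype.card W + 1) with hD
    have hDpos : 0 < D := by positivity
    have h2D : 2 ^ (m + 1) * (Fintype.card W + 1) = 2 * D := by rw [hD]; ring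
    rw [h2D] at h ihA
    obtain ⟨U, hUA, hUne, hUc, hUd, hdeg⟩ := G.exists_connected_nbhdIn hA h
    have hss : A \ U ⊂ A := Finset.sdiff_ssubset hUA hUne
    -- If `U` has no neighbours in `A`, the density sits in `A \ U`, a smaller set.
    rcases (G.nbhdIn A U).eq_empty_or_nonempty with hN | hN
    · rw [hN, Finset.card_empty, mul_zero, add_zero] at hUd
      have hne : (A \ U).Nonempty := by
        rw [Finset.nonempty_iff_ne_empty]
        intro h0
        rw [h0] at hUd
        simp [dartCount] at hUd
        omega
      exact (ihA _ hss hne (le_trans (Nat.mul_le_mul_left _ (Nat.le_succ _)) hUd)).mono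
        (by exact_mod_cast hss.subset)
    · have hmod := ih (H.deleteEdges {e}) hHe (G.nbhdIn A U) hN (by
        have hsum := Finset.card_nsmul_le_sum (G.nbhdIn A U)
          (fun v => #{w ∈ G.nbhdIn A U | G.Adj v w}) D hdeg
        rw [smul_eq_mul, mul_comm] at hsum
        exact hsum)
      have hNsub : G.nbhdIn A U ⊆ A \ U := Finset.filter_subset _ _
      refine (HasModelIn.of_deleteEdges (U := (U : Set V)) ?_ ?_ ?_ hmod).mono ?_
      · rw [Finset.disjoint_coe]
        exact Finset.disjoint_of_subset_left hNsub Finset.sdiff_disjoint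
      · exact_mod_cast hUc
      · intro v hv
        exact_mod_cast (Finset.mem_filter.1 (Finset.mem_coe.1 hv)).2
      · rw [Set.union_subset_iff]
        exact ⟨by exact_mod_cast hNsub.trans hss.subset, by exact_mod_cast hUA⟩

/-! ### Linear admissibility -/

/-- If every nonempty vertex subset of a `d`-sparse graph has a vertex of small degree, then there
is a large independent set. -/
theorem exists_independent_of_dartCount_lt (K : SimpleGraph V) {D : ℕ} (S : Finset V)
    (h : ∀ T ⊆ S, T.Nonempty → K.dartCount T < D * #T) :
    ∃ R ⊆ S, (∀ v ∈ R, ∀ w ∈ R, ¬ K.Adj v w) ∧ #S ≤ D * #R := by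
  induction S using Finset.strongInduction with
  | H S ih =>
  rcases S.eq_empty_or_nonempty with rfl | hS
  · exact ⟨∅, by simp⟩
  obtain ⟨v, hv, hdeg⟩ : ∃ v ∈ S, #{w ∈ S | K.Adj v w} < D := by
    by_contra! hge
    have := h S subset_rfl hS
    have h2 := Finset.card_nsmul_le_sum S _ D hge
    rw [smul_eq_mul, mul_comm] at h2
    exact absurd this (not_lt.2 h2)
  -- Greedy choice: `v` and its neighbours are at most `D` vertices.
  set T := S \ insert v {w ∈ S | K.Adj v w} with hT
  have hTS : T ⊂ S := Finset.sdiff_ssubset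
    (Finset.insert_subset hv (Finset.filter_subset _ _)) (Finset.insert_nonempty _ _)
  obtain ⟨R, hRT, hR, hcard⟩ := ih T hTS (fun T' hT' => h T' (hT'.trans hTS.subset))
  have hvR : v ∉ R := fun hvR => by
    have := hRT hvR
    simp [hT] at this
  have hnadj : ∀ w ∈ R, ¬ K.Adj v w := by
    intro w hw hvw
    have := hRT hw
    simp only [hT, mem_sdiff, mem_insert, mem_filter] at this
    tauto
  refine ⟨insert v R, Finset.insert_subset hv (hRT.trans hTS.subset), ?_, ?_⟩
  · intro a ha c hc hac
    rcases Finset.mem_insert.1 ha with ha' | ha' <;>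
      rcases Finset.mem_insert.1 hc with hc' | hc'
    · exact hac.ne (ha'.trans hc'.symm)
    · exact hnadj c hc' (ha' ▸ hac)
    · exact hnadj a ha' (hc' ▸ hac.symm)
    · exact hR a ha' c hc' hac
  · rw [Finset.card_insert_of_notMem hvR]
    have h1 : #S ≤ #T + #(insert v {w ∈ S | K.Adj v w}) := by
      have := Finset.le_card_sdiff (insert v {w ∈ S | K.Adj v w}) S
      rw [← hT] at this
      omega
    have h2 := Finset.card_insert_le v {w ∈ S | K.Adj v w}
    rw [Nat.mul_add]
    omega

/-- The part of a walk up to its first vertex in `A`. -/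
theorem Walk.exists_first_mem {G : SimpleGraph V} (A : Set V) {a w : V} (q : G.Walk a w)
    (hw : w ∈ A) : ∃ x ∈ A, x ∈ q.support ∧ ∃ I : Finset V, (∀ y ∈ I, y ∈ q.support ∧ y ∉ A) ∧
      #I ≤ q.length ∧ (∃ p : G.Walk a x, ∀ z ∈ p.support, z = x ∨ z ∈ I) ∧
      ∀ y ∈ I, ∃ p : G.Walk a y, ∀ z ∈ p.support, z ∈ I := by
  induction q with
  | nil => exact ⟨_, hw, by simp, ∅, by simp, by simp, ⟨Walk.nil, by simp⟩, by simp⟩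
  | @cons a c w hac q ih =>
    by_cases ha : a ∈ A
    · exact ⟨a, ha, by simp, ∅, by simp, by simp, ⟨Walk.nil, by simp⟩, by simp⟩
    · obtain ⟨x, hxA, hx, I, hI, hIc, ⟨p, hp⟩, hI'⟩ := ih hw
      refine ⟨x, hxA, by simp [hx], insert a I, ?_, ?_, ⟨Walk.cons hac p, ?_⟩, ?_⟩
      · intro y hy
        rcases Finset.mem_insert.1 hy with rfl | hy
        · exact ⟨by simp, ha⟩
        · exact ⟨by simp [(hI y hy).1], (hI y hy).2⟩
      · exact (Finset.card_insert_le _ _).trans (by simpa using hIc)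
      · intro z hz
        rw [Walk.support_cons, List.mem_cons] at hz
        rcases hz with rfl | hz
        · simp
        · rcases hp z hz with h | h <;> simp [h]
      · intro y hy
        rcases Finset.mem_insert.1 hy with rfl | hy
        · exact ⟨Walk.nil, by simp⟩
        · obtain ⟨p', hp'⟩ := hI' y hy
          refine ⟨Walk.cons hac p', fun z hz => ?_⟩
          rw [Walk.support_cons, List.mem_cons] at hz
          rcases hz with rfl | hz
          · simp
          · simp [hp' z hz]

/-- A family of paths of length at most `r` that start in `v`, end in `S`, and pairwise meet
exactly in `v`. -/
def IsFamilyInto (G : SimpleGraph V) (S : Set V) (r : ℕ) (v : V)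
    (F : Finset (Σ y : V, G.Path v y)) : Prop :=
  (∀ P ∈ F, (P.2 : G.Walk v P.1).length ≤ r ∧ P.1 ∈ S) ∧
  ∀ P ∈ F, ∀ Q ∈ F, P ≠ Q →
    {z | z ∈ (P.2 : G.Walk v P.1).support} ∩ {z | z ∈ (Q.2 : G.Walk v Q.1).support} = {v}

/-- `I` describes the inner vertices of a fan of paths of `G` from `v` to the vertices of `E`, whose
inner vertices avoid `A`. -/
def IsFan (G : SimpleGraph V) (A : Set V) (r : ℕ) (v : V) (E : Finset V)
    (I : V → Finset V) : Prop :=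
  (∀ x ∈ E, x ∈ A ∧ x ≠ v ∧ #(I x) ≤ r ∧ (∀ y ∈ I x, y ∉ A) ∧
    (∃ p : G.Walk v x, ∀ z ∈ p.support, z = v ∨ z = x ∨ z ∈ I x) ∧
    ∀ y ∈ I x, ∃ p : G.Walk v y, ∀ z ∈ p.support, z = v ∨ z ∈ I x) ∧
  ∀ x ∈ E, ∀ x' ∈ E, x ≠ x' → Disjoint (I x) (I x')

/-- The first edge is split off before cutting, because `v` itself may lie in `A`. -/
theorem Path.exists_first_mem {G : SimpleGraph V} {A : Set V} {r : ℕ} {v w : V} (P : G.Path v w)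
    (hP : (P : G.Walk v w).length ≤ r) (hw : w ∈ A) (hwv : w ≠ v) :
    ∃ (x : V) (I : Finset V), x ∈ A ∧ x ≠ v ∧ x ∈ (P : G.Walk v w).support ∧ #I ≤ r ∧
      (∀ y ∈ I, y ∈ (P : G.Walk v w).support ∧ y ≠ v ∧ y ∉ A) ∧
      (∃ p : G.Walk v x, ∀ z ∈ p.support, z = v ∨ z = x ∨ z ∈ I) ∧
      ∀ y ∈ I, ∃ p : G.Walk v y, ∀ z ∈ p.support, z = v ∨ z ∈ I := by
  obtain ⟨p, hp⟩ := P
  cases p with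
  | nil => exact absurd rfl hwv
  | @cons _ a _ hva q =>
    rw [Walk.cons_isPath_iff] at hp
    simp only [Walk.length_cons] at hP
    obtain ⟨x, hxA, hx, I, hI, hIc, ⟨p, hp'⟩, hI'⟩ := q.exists_first_mem A hw
    refine ⟨x, I, hxA, ?_, by simp [hx], by omega, ?_, ⟨Walk.cons hva p, ?_⟩, ?_⟩
    · rintro rfl
      exact hp.2 hx
    · intro y hy
      refine ⟨by simp [(hI y hy).1], ?_, (hI y hy).2⟩
      rintro rfl
      exact hp.2 (hI y hy).1
    · intro z hz
      rw [Walk.support_cons, List.mem_cons] at hz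
      exact hz.imp_right (hp' z)
    · intro y hy
      obtain ⟨p', hp'⟩ := hI' y hy
      refine ⟨Walk.cons hva p', fun z hz => ?_⟩
      rw [Walk.support_cons, List.mem_cons] at hz
      exact hz.imp_right (hp' z)

theorem IsFamilyInto.exists_isFan {G : SimpleGraph V} {S A : Set V} (hSA : S ⊆ A) {r : ℕ} {v : V}
    {F : Finset (Σ y : V, G.Path v y)} (hF : G.IsFamilyInto S r v F) :
    ∃ (E : Finset V) (I : V → Finset V), #F ≤ #E + 1 ∧ G.IsFan A r v E I := by
  set F' := F.filter (fun P => P.1 ≠ v) with hF'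
  -- Only the trivial path ends in `v`.
  have hcard : #F ≤ #F' + 1 := by
    rw [← Finset.card_filter_add_card_filter_not (s := F) (fun P => P.1 ≠ v)]
    refine Nat.add_le_add_left (Finset.card_le_one.2 ?_) _
    rintro ⟨y, P⟩ hP ⟨z, Q⟩ hQ
    simp only [mem_filter, not_not] at hP hQ
    obtain ⟨-, rfl⟩ := hP
    obtain ⟨-, rfl⟩ := hQ
    rw [Path.loop_eq P, Path.loop_eq Q]
  have hex : ∀ P : (Σ y : V, G.Path v y), ∃ (x : V) (I : Finset V), P ∈ F' →
      x ∈ A ∧ x ≠ v ∧ x ∈ (P.2 : G.Walk v P.1).support ∧ #I ≤ r ∧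
      (∀ y ∈ I, y ∈ (P.2 : G.Walk v P.1).support ∧ y ≠ v ∧ y ∉ A) ∧
      (∃ p : G.Walk v x, ∀ z ∈ p.support, z = v ∨ z = x ∨ z ∈ I) ∧
      ∀ y ∈ I, ∃ p : G.Walk v y, ∀ z ∈ p.support, z = v ∨ z ∈ I := by
    intro P
    by_cases hP : P ∈ F'
    · have hP' := Finset.mem_filter.1 hP
      obtain ⟨x, I, h⟩ := P.2.exists_first_mem (hF.1 P hP'.1).1 (hSA (hF.1 P hP'.1).2) hP'.2
      exact ⟨x, I, fun _ => h⟩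
    · exact ⟨v, ∅, fun h => absurd h hP⟩
  choose x I hxI using hex
  have hmeet : ∀ P ∈ F', ∀ Q ∈ F', ∀ z, z ≠ v → z ∈ (P.2 : G.Walk v P.1).support →
      z ∈ (Q.2 : G.Walk v Q.1).support → P = Q := by
    intro P hP Q hQ z hz hzP hzQ
    by_contra hne
    have := hF.2 P (Finset.mem_filter.1 hP).1 Q (Finset.mem_filter.1 hQ).1 hne
    rw [Set.ext_iff] at this
    exact hz ((this z).1 ⟨hzP, hzQ⟩)
  have hinj : Set.InjOn x F' := by
    intro P hP Q hQ hPQ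
    have h1 := hxI P hP
    have h2 := hxI Q hQ
    exact hmeet P hP Q hQ (x P) h1.2.1 h1.2.2.1 (hPQ ▸ h2.2.2.1)
  have hI : ∀ y, ∃ J : Finset V, y ∈ F'.image x → ∃ P ∈ F', x P = y ∧ J = I P := by
    intro y
    by_cases hy : y ∈ F'.image x
    · obtain ⟨P, hP, hPy⟩ := Finset.mem_image.1 hy
      exact ⟨I P, fun _ => ⟨P, hP, hPy, rfl⟩⟩
    · exact ⟨∅, fun h => absurd h hy⟩
  choose J hJ using hI
  refine ⟨F'.image x, J, ?_, ?_, ?_⟩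
  · rwa [Finset.card_image_of_injOn hinj]
  · intro y hy
    obtain ⟨P, hP, rfl, hJP⟩ := hJ y hy
    obtain ⟨h1, h2, -, h3, h4, h5⟩ := hxI P hP
    rw [hJP]
    exact ⟨h1, h2, h3, fun y hy => (h4 y hy).2.2, h5⟩
  · intro y hy y' hy' hne
    obtain ⟨P, hP, rfl, hJP⟩ := hJ y hy
    obtain ⟨P', hP', rfl, hJP'⟩ := hJ y' hy'
    rw [hJP, hJP', Finset.disjoint_left]
    intro z hz hz'
    have h := (hxI P hP).2.2.2.2.1 z hz
    have h' := (hxI P' hP').2.2.2.2.1 z hz'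
    exact hne (congrArg x (hmeet P hP P' hP' z h.2.1 h.1 h'.1))

/-- Mader's theorem in `K` would give a model that the linkage expands into `G`. -/
theorem IsLinkage.dartCount_lt [Fintype W] {H : SimpleGraph W} {G K : SimpleGraph V} {A : Set V}
    {J : Sym2 V → Set V} (hK : G.IsLinkage K A J) (hH : ¬ H.IsTopologicalMinor G) {T : Finset V}
    (hTA : (T : Set V) ⊆ A) (hT : T.Nonempty) :
    K.dartCount T < 2 ^ H.edgeSet.ncard * (Fintype.card W + 1) * #T := by
  by_contra hge
  exact hH (((hasModelIn_of_dartCount K _ H rfl T hT (not_lt.1 hge)).mono hTA).of_isLinkage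
    hK).isTopologicalMinor

theorem IsLinkage.add_edge {G K : SimpleGraph V} {A : Set V} {J : Sym2 V → Set V}
    (hK : G.IsLinkage K A J) {v w : V} (hv : v ∈ A) (hw : w ∈ A) (hvw : ¬ K.Adj v w) {X : Set V}
    (hXA : Disjoint X A) (hXJ : ∀ e ∈ K.edgeSet, Disjoint (J e) X)
    (hX : ∃ p : G.Walk v w, ∀ z ∈ p.support, z = v ∨ z = w ∨ z ∈ X) :
    G.IsLinkage (K ⊔ edge v w) A (Function.update J s(v, w) X) := by
  have hne : ∀ a c, K.Adj a c → s(a, c) ≠ s(v, w) := by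
    intro a c hac h
    rw [← mem_edgeSet, h] at hac
    exact hvw hac
  have hmem : ∀ e ∈ (K ⊔ edge v w).edgeSet, e ≠ s(v, w) → e ∈ K.edgeSet := by
    intro e
    induction e with
    | _ a c =>
    intro he hne
    rw [mem_edgeSet, sup_adj, edge_adj] at he
    rcases he with he | ⟨he, -⟩
    · exact he
    · exact absurd (Sym2.eq_iff.2 (by tauto)) hne
  refine ⟨?_, ?_, ?_, ?_⟩
  · intro a c hac
    rw [sup_adj, edge_adj] at hac
    rcases hac with hac | ⟨⟨rfl, rfl⟩ | ⟨rfl, rfl⟩, -⟩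
    · exact hK.1 a c hac
    · exact hv
    · exact hw
  · intro e
    rw [Function.update_apply]
    split_ifs
    · exact hXA
    · exact hK.2.1 e
  · intro e he e' he' hee
    rw [Function.update_apply, Function.update_apply]
    split_ifs with h1 h2 h2
    · exact absurd (h1.trans h2.symm) hee
    · exact (hXJ e' (hmem e' he' h2)).symm
    · exact hXJ e (hmem e he h1)
    · exact hK.2.2.1 e (hmem e he h1) e' (hmem e' he' h2) hee
  · intro a c hac
    rw [sup_adj, edge_adj] at hac
    rcases hac with hac | ⟨⟨rfl, rfl⟩ | ⟨rfl, rfl⟩, -⟩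
    · rw [Function.update_of_ne (hne a c hac)]
      exact hK.2.2.2 a c hac
    · rwa [Function.update_self]
    · obtain ⟨p, hp⟩ := hX
      rw [Sym2.eq_swap, Function.update_self]
      refine ⟨p.reverse, fun z hz => ?_⟩
      rw [Walk.support_reverse, List.mem_reverse] at hz
      have := hp z hz
      tauto

/-- Fans with pairwise disjoint sets of inner vertices give a dense linkage. -/
theorem exists_isLinkage_of_isFan {G : SimpleGraph V} {A R : Finset V} (hRA : R ⊆ A) {r k : ℕ}
    {E : V → Finset V} {I : V → V → Finset V} (hE : ∀ v ∈ R, G.IsFan A r v (E v) (I v))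
    (hk : ∀ v ∈ R, k ≤ #(E v))
    (hdisj : ∀ v ∈ R, ∀ w ∈ R, v ≠ w → ∀ x ∈ E v, ∀ y ∈ E w, Disjoint (I v x) (I w y)) :
    ∃ (K : SimpleGraph V) (J : Sym2 V → Set V), G.IsLinkage K A J ∧ k * #R ≤ K.dartCount A := by
  obtain ⟨K, hKadj⟩ : ∃ K : SimpleGraph V,
      ∀ a c, K.Adj a c ↔ (a ∈ R ∧ c ∈ E a) ∨ (c ∈ R ∧ a ∈ E c) :=
    ⟨{ Adj := fun a c => (a ∈ R ∧ c ∈ E a) ∨ (c ∈ R ∧ a ∈ E c)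
       symm := ⟨fun a c h => h.symm⟩
       loopless := ⟨fun a h => by
         have h : a ∈ R ∧ a ∈ E a := h.elim id id
         exact ((hE a h.1).1 a h.2).2.1 rfl⟩ }, fun _ _ => Iff.rfl⟩
  refine ⟨K, fun e => {z | ∃ v ∈ R, ∃ x ∈ E v, e = s(v, x) ∧ z ∈ I v x}, ⟨?_, ?_, ?_, ?_⟩, ?_⟩
  · intro a c hac
    rcases (hKadj a c).1 hac with ⟨ha, hc⟩ | ⟨hc, ha⟩
    · exact hRA ha
    · exact ((hE c hc).1 a ha).1
  · intro e
    rw [Set.disjoint_left]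
    rintro z ⟨v, hv, x, hx, -, hz⟩
    exact ((hE v hv).1 x hx).2.2.2.1 z hz
  · intro e _ e' _ hne
    rw [Set.disjoint_left]
    rintro z ⟨v, hv, x, hx, rfl, hz⟩ ⟨v', hv', x', hx', rfl, hz'⟩
    by_cases hvv : v = v'
    · subst hvv
      have hxx : x ≠ x' := by
        rintro rfl
        exact hne rfl
      exact Finset.disjoint_left.1 ((hE v hv).2 x hx x' hx' hxx) hz hz'
    · exact Finset.disjoint_left.1 (hdisj v hv v' hv' hvv x hx x' hx') hz hz'
  · intro a c hac
    rcases (hKadj a c).1 hac with ⟨ha, hc⟩ | ⟨hc, ha⟩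
    · obtain ⟨p, hp⟩ := ((hE a ha).1 c hc).2.2.2.2.1
      exact ⟨p, fun z hz => (hp z hz).imp_right fun h => h.imp_right fun h =>
        ⟨a, ha, c, hc, rfl, h⟩⟩
    · obtain ⟨p, hp⟩ := ((hE c hc).1 a ha).2.2.2.2.1
      refine ⟨p.reverse, fun z hz => ?_⟩
      rw [Walk.support_reverse, List.mem_reverse] at hz
      rcases hp z hz with h | h | h
      · exact Or.inr (Or.inl h)
      · exact Or.inl h
      · exact Or.inr (Or.inr ⟨c, hc, a, ha, Sym2.eq_swap, h⟩)
  · calc k * #R = ∑ v ∈ R, k := by rw [Finset.sum_const, smul_eq_mul, mul_comm]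
      _ ≤ ∑ v ∈ R, #{w ∈ A | K.Adj v w} := by
          refine Finset.sum_le_sum fun v hv => (hk v hv).trans (Finset.card_le_card ?_)
          intro x hx
          rw [Finset.mem_filter]
          exact ⟨((hE v hv).1 x hx).1, (hKadj v x).2 (Or.inl ⟨hv, hx⟩)⟩
      _ ≤ K.dartCount A :=
          Finset.sum_le_sum_of_subset (f := fun v => #{w ∈ A | K.Adj v w}) hRA

/-- In a finite graph without the topological minor `H`, every nonempty set `S` of vertices has a
member from which only linearly many disjoint paths of length at most `r` lead to `S`. -/
theorem exists_card_family_le [Finite V] [Fintype W] {H : SimpleGraph W} {G : SimpleGraph V}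
    (hH : ¬ H.IsTopologicalMinor G) {D r : ℕ}
    (hD : D = 2 ^ H.edgeSet.ncard * (Fintype.card W + 1)) (hr : 1 ≤ r) {S : Finset V}
    (hS : S.Nonempty) :
    ∃ v ∈ S, ∀ F, G.IsFamilyInto S r v F → #F ≤ D ^ 2 * (1 + 2 * D) * r := by
  by_contra! hcon
  -- The bound `2 * r` leaves room for an edge made of two fan paths that meet, each with at most
  -- `r` inner vertices.
  set P : SimpleGraph V → Prop := fun K => ∃ J : Sym2 V → Finset V,
    G.IsLinkage K S (fun e => J e) ∧ ∀ e, #(J e) ≤ 2 * r with hP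
  have hP0 : P ⊥ := ⟨fun _ => ∅, ⟨by simp, by simp, by simp, by simp⟩, by simp⟩
  obtain ⟨K, hK, hmax⟩ := (Set.toFinite {K | P K}).exists_maximal ⟨⊥, hP0⟩
  obtain ⟨J, hKJ, hJr⟩ := hK
  have hKd : ∀ T ⊆ S, T.Nonempty → K.dartCount T < D * #T := fun T hTS hT =>
    hD ▸ hKJ.dartCount_lt hH (by exact_mod_cast hTS) hT
  obtain ⟨R, hRS, hR, hSR⟩ := K.exists_independent_of_dartCount_lt S hKd
  set M := S.biUnion fun v => {w ∈ S | K.Adj v w}.biUnion fun w => J s(v, w) with hM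
  have hJM : ∀ e ∈ K.edgeSet, J e ⊆ M := by
    intro e
    induction e with
    | _ a c =>
    intro he z hz
    simp only [hM, mem_biUnion, mem_filter]
    exact ⟨a, hKJ.1 a c he, c, ⟨hKJ.1 c a (K.adj_symm he), he⟩, hz⟩
  have hMcard : #M ≤ K.dartCount S * (2 * r) := by
    rw [dartCount, Finset.sum_mul]
    refine Finset.card_biUnion_le.trans (Finset.sum_le_sum fun v _ => ?_)
    exact Finset.card_biUnion_le_card_mul _ _ _ fun w _ => hJr _
  set A := S ∪ M with hA
  have hSA : (S : Set V) ⊆ (A : Set V) := by exact_mod_cast Finset.subset_union_left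
  have hfan : ∀ v, ∃ (E : Finset V) (I : V → Finset V), v ∈ S →
      D ^ 2 * (1 + 2 * D) * r ≤ #E ∧ G.IsFan A r v E I := by
    intro v
    by_cases hv : v ∈ S
    · obtain ⟨F, hF, hFc⟩ := hcon v hv
      obtain ⟨E, I, h1, h2⟩ := hF.exists_isFan hSA
      exact ⟨E, I, fun _ => ⟨by omega, h2⟩⟩
    · exact ⟨∅, fun _ => ∅, fun h => absurd h hv⟩
  choose E I hEI using hfan
  -- A common vertex `z` would join `v` to `w` outside `A`, hence away from all inner sets in use,
  -- contradicting the maximality of `K`.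
  have hdisj : ∀ v ∈ R, ∀ w ∈ R, v ≠ w → ∀ x ∈ E v, ∀ y ∈ E w, Disjoint (I v x) (I w y) := by
    intro v hv w hw hvw x hx y hy
    by_contra hnd
    obtain ⟨z, hz, hz'⟩ := Finset.not_disjoint_iff.1 hnd
    obtain ⟨-, -, hc1, ha1, -, hp1⟩ := (hEI v (hRS hv)).2.1 x hx
    obtain ⟨-, -, hc2, ha2, -, hp2⟩ := (hEI w (hRS hw)).2.1 y hy
    obtain ⟨p, hp⟩ := hp1 z hz
    obtain ⟨q, hq⟩ := hp2 z hz'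
    have hXA : ∀ t ∈ I v x ∪ I w y, t ∉ A := by
      intro t ht
      exact (Finset.mem_union.1 ht).elim (ha1 t) (ha2 t)
    have hadd := hKJ.add_edge (v := v) (w := w) (X := (I v x ∪ I w y : Finset V))
      (hRS hv) (hRS hw) (hR v hv w hw) ?_ ?_ ?_
    · have hPK : P (K ⊔ edge v w) := by
        refine ⟨Function.update J s(v, w) (I v x ∪ I w y), ?_, ?_⟩
        · convert hadd using 2 with e
          by_cases he : e = s(v, w)
          · subst he; simp
          · simp [he]
        · intro e
          rw [Function.update_apply]
          split_ifs
          · have := Finset.card_union_le (I v x) (I w y)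
            omega
          · exact hJr e
      have hle := hmax hPK le_sup_left
      exact hR v hv w hw (hle (by simp [edge_adj, hvw]))
    · rw [Finset.disjoint_coe, Finset.disjoint_left]
      exact fun t ht htS => hXA t ht (Finset.mem_union_left _ htS)
    · intro e he
      rw [Finset.disjoint_coe, Finset.disjoint_left]
      exact fun t ht htX => hXA t htX (Finset.mem_union_right _ (hJM e he ht))
    · refine ⟨p.append q.reverse, fun t ht => ?_⟩
      rw [Walk.mem_support_append_iff, Walk.support_reverse, List.mem_reverse] at ht
      rw [Finset.mem_coe, Finset.mem_union]
      rcases ht with ht | ht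
      · have := hp t ht
        tauto
      · have := hq t ht
        tauto
  obtain ⟨K', J', hK', hdense⟩ := exists_isLinkage_of_isFan (hRS.trans Finset.subset_union_left)
    (fun v hv => (hEI v (hRS hv)).2) (fun v hv => (hEI v (hRS hv)).1) hdisj
  have hsparse := hK'.dartCount_lt hH subset_rfl (hS.mono Finset.subset_union_left)
  rw [← hD] at hsparse
  have hAcard : #A ≤ #S + D * #S * (2 * r) := by
    have h1 := Finset.card_union_le S M
    rw [← hA] at h1
    have h2 := Nat.mul_le_mul_right (2 * r) (hKd S subset_rfl hS).le
    omega
  have hDpos : 0 < D := by rw [hD]; positivity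
  -- One factor `D` comes from `#S ≤ D * #R`, one from sparsity of `K'`, and `(1 + 2 * D) * r` from
  -- `#A`.
  have hlt : D ^ 2 * (1 + 2 * D) * r * #S < D ^ 2 * (1 + 2 * D) * r * #S := by
    calc D ^ 2 * (1 + 2 * D) * r * #S ≤ D ^ 2 * (1 + 2 * D) * r * (D * #R) :=
          Nat.mul_le_mul_left _ hSR
      _ = D * (D ^ 2 * (1 + 2 * D) * r * #R) := by ring
      _ < D * (D * #A) := Nat.mul_lt_mul_of_pos_left (hdense.trans_lt hsparse) hDpos
      _ ≤ D * (D * (#S + D * #S * (2 * r))) := by gcongr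
      _ ≤ D * (D * (#S * r + D * #S * (2 * r))) := by
          gcongr
          exact Nat.le_mul_of_pos_right _ hr
      _ = D ^ 2 * (1 + 2 * D) * r * #S := by ring
  exact lt_irrefl _ hlt

/-- Greedy construction of a linear order, in which every vertex is preceded by those that are
removed later. -/
theorem exists_order_of_family_le {G : SimpleGraph V} {r k : ℕ}
    (h : ∀ S : Finset V, S.Nonempty → ∃ v ∈ S, ∀ F, G.IsFamilyInto S r v F → #F ≤ k)
    (S : Finset V) :
    ∃ L : V → ℕ, Set.InjOn L S ∧ (∀ v ∈ S, L v < #S) ∧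
      ∀ v ∈ S, ∀ F, G.IsFamilyInto {w | w ∈ S ∧ L w ≤ L v} r v F → #F ≤ k := by
  induction S using Finset.strongInduction with
  | H S ih =>
  rcases S.eq_empty_or_nonempty with rfl | hS
  · exact ⟨fun _ => 0, by simp⟩
  obtain ⟨v, hv, hvF⟩ := h S hS
  obtain ⟨L, hinj, hlt, hL⟩ := ih (S.erase v) (Finset.erase_ssubset hv)
  have hcard := Finset.card_erase_add_one hv
  have hlt' : ∀ w ∈ S, w ≠ v → L w < #(S.erase v) := fun w hw hwv =>
    hlt w (Finset.mem_erase.2 ⟨hwv, hw⟩)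
  have hof : ∀ w, w ≠ v → Function.update L v #(S.erase v) w = L w := fun w hw =>
    Function.update_of_ne hw _ _
  -- The chosen `v` becomes the largest vertex of `S`, so the vertices up to `v` are exactly those
  -- of `S`.
  refine ⟨Function.update L v #(S.erase v), ?_, ?_, ?_⟩
  · intro a ha c hc hac
    by_cases hav : a = v <;> by_cases hcv : c = v
    · rw [hav, hcv]
    · rw [hav, Function.update_self, hof c hcv] at hac
      exact absurd hac (hlt' c hc hcv).ne'
    · rw [hcv, Function.update_self, hof a hav] at hac
      exact absurd hac (hlt' a ha hav).ne
    · rw [hof a hav, hof c hcv] at hac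
      exact hinj (Finset.mem_erase.2 ⟨hav, ha⟩) (Finset.mem_erase.2 ⟨hcv, hc⟩) hac
  · intro w hw
    by_cases hwv : w = v
    · rw [hwv, Function.update_self]
      omega
    · rw [hof w hwv]
      have := hlt' w hw hwv
      omega
  · intro w hw F hF
    by_cases hwv : w = v
    · subst hwv
      exact hvF F ⟨fun P hP => ⟨(hF.1 P hP).1, (hF.1 P hP).2.1⟩, hF.2⟩
    · refine hL w (Finset.mem_erase.2 ⟨hwv, hw⟩) F ⟨fun P hP => ⟨(hF.1 P hP).1, ?_⟩, hF.2⟩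
      obtain ⟨h1, h2⟩ := (hF.1 P hP).2
      have hPv : P.1 ≠ v := by
        intro hPv
        rw [hPv, Function.update_self, hof w hwv] at h2
        exact absurd h2 (not_le.2 (hlt' w hw hwv))
      rw [hof w hwv, hof _ hPv] at h2
      exact ⟨Finset.mem_erase.2 ⟨hPv, h1⟩, h2⟩

theorem exists_order_adm_le [Finite V] [Fintype W] {H : SimpleGraph W} {G : SimpleGraph V}
    (hH : ¬ H.IsTopologicalMinor G) {D r : ℕ}
    (hD : D = 2 ^ H.edgeSet.ncard * (Fintype.card W + 1)) (hr : 1 ≤ r) :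
    ∃ L : V ↪ ℕ, ∀ x F, G.IsAdmFamily L r x F → #F ≤ D ^ 2 * (1 + 2 * D) * r := by
  have := Fintype.ofFinite V
  obtain ⟨L, hinj, -, hL⟩ := exists_order_of_family_le (G := G)
    (fun S hS => exists_card_family_le hH hD hr hS) Finset.univ
  refine ⟨⟨L, fun a c h => hinj (by simp) (by simp) h⟩, fun x F hF => hL x (by simp) F ⟨?_, hF.2⟩⟩
  exact fun P hP => ⟨(hF.1 P hP).1, by simp, (hF.1 P hP).2⟩

/-! ### From admissibility to weak colouring numbers -/

/-- `G.StrongReach L x n y`: there is a walk of length `n` from `x` to `y` all of whose vertices,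
except possibly `y`, are at least `x` in the order. -/
def StrongReach (G : SimpleGraph V) (L : V ↪ ℕ) (x : V) : ℕ → V → Prop
  | 0, y => y = x
  | n + 1, y => ∃ z, StrongReach G L x n z ∧ L x ≤ L z ∧ G.Adj z y

/-- Existence of a breadth-first search tree: `d` is the level and `par` the parent. -/
theorem exists_bfs (G : SimpleGraph V) (L : V ↪ ℕ) (x : V) :
    ∃ (d : V → ℕ) (par : V → V),
      (∀ n y, G.StrongReach L x n y → d y ≤ n ∧ G.StrongReach L x (d y) y) ∧
      ∀ y m, G.StrongReach L x (d y) y → d y = m + 1 →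
        d (par y) = m ∧ G.StrongReach L x m (par y) ∧ L x ≤ L (par y) ∧ G.Adj (par y) y := by
  set d : V → ℕ := fun y => sInf {n | G.StrongReach L x n y} with hd
  have h1 : ∀ n y, G.StrongReach L x n y → d y ≤ n ∧ G.StrongReach L x (d y) y :=
    fun n y h => ⟨Nat.sInf_le h, Nat.sInf_mem (s := {n | G.StrongReach L x n y}) ⟨n, h⟩⟩
  have h2 : ∀ y, ∃ z, ∀ m, G.StrongReach L x (d y) y → d y = m + 1 →
      d z = m ∧ G.StrongReach L x m z ∧ L x ≤ L z ∧ G.Adj z y := by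
    intro y
    by_cases hy : ∃ m, G.StrongReach L x (d y) y ∧ d y = m + 1
    · obtain ⟨m, hr, hm⟩ := hy
      obtain ⟨z, hz, hxz, hzy⟩ : G.StrongReach L x (m + 1) y := hm ▸ hr
      refine ⟨z, fun m' _ hm' => ?_⟩
      obtain rfl : m = m' := by omega
      refine ⟨le_antisymm (h1 m z hz).1 ?_, hz, hxz, hzy⟩
      have := (h1 (d z + 1) y ⟨z, (h1 m z hz).2, hxz, hzy⟩).1
      omega
    · exact ⟨x, fun m h h' => absurd ⟨m, h, h'⟩ hy⟩
  choose par hpar using h2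
  exact ⟨d, par, h1, hpar⟩

/-- The form in which admissibility is applied: walks confined to disjoint sets apart from `x`
shorten to an admissible family. The condition `t c ≠ x` keeps these paths distinct. -/
theorem card_le_of_isAdmFamily {G : SimpleGraph V} {L : V ↪ ℕ} {r k : ℕ} {x : V}
    (hk : ∀ F, G.IsAdmFamily L r x F → #F ≤ k) (S : Finset V) (t : V → V) (B : V → Set V)
    (hB : ∀ c ∈ S, ∀ c' ∈ S, c ≠ c' → Disjoint (B c) (B c'))
    (h : ∀ c ∈ S, t c ≠ x ∧ L (t c) ≤ L x ∧
      ∃ p : G.Walk x (t c), p.length ≤ r ∧ ∀ z ∈ p.support, z = x ∨ z ∈ B c) :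
    #S ≤ k := by
  have hP : ∀ c, ∃ P : (Σ y : V, G.Path x y), c ∈ S → P.1 = t c ∧
      (P.2 : G.Walk x P.1).length ≤ r ∧ ∀ z ∈ (P.2 : G.Walk x P.1).support, z = x ∨ z ∈ B c := by
    intro c
    by_cases hc : c ∈ S
    · obtain ⟨-, -, p, hp, hpB⟩ := h c hc
      exact ⟨⟨t c, p.bypass, p.bypass_isPath⟩, fun _ => ⟨rfl, p.length_bypass_le_length.trans hp,
        fun z hz => hpB z (p.support_bypass_subset_support hz)⟩⟩
    · exact ⟨⟨x, Path.nil⟩, fun h => absurd h hc⟩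
  choose P hP using hP
  have hmeet : ∀ c ∈ S, ∀ c' ∈ S, c ≠ c' → ∀ z, z ∈ ((P c).2 : G.Walk x (P c).1).support →
      z ∈ ((P c').2 : G.Walk x (P c').1).support → z = x := by
    intro c hc c' hc' hne z hz hz'
    rcases (hP c hc).2.2 z hz with h1 | h1
    · exact h1
    rcases (hP c' hc').2.2 z hz' with h2 | h2
    · exact h2
    exact absurd h2 (Set.disjoint_left.1 (hB c hc c' hc' hne) h1)
  have hinj : Set.InjOn P S := by
    intro c hc c' hc' hcc
    by_contra hne
    refine (h c hc).1 ?_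
    rw [← (hP c hc).1]
    exact hmeet c hc c' hc' hne _ (Walk.end_mem_support _) (hcc ▸ Walk.end_mem_support _)
  rw [← Finset.card_image_of_injOn hinj]
  refine hk _ ⟨?_, ?_⟩
  · intro Q hQ
    obtain ⟨c, hc, rfl⟩ := Finset.mem_image.1 hQ
    exact ⟨(hP c hc).2.1, (hP c hc).1 ▸ (h c hc).2.1⟩
  · intro Q hQ Q' hQ' hne
    obtain ⟨c, hc, rfl⟩ := Finset.mem_image.1 hQ
    obtain ⟨c', hc', rfl⟩ := Finset.mem_image.1 hQ'
    refine Set.Subset.antisymm ?_ ?_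
    · rintro z ⟨hz, hz'⟩
      exact hmeet c hc c' hc' (fun h => hne (h ▸ rfl)) z hz hz'
    · rintro z rfl
      exact ⟨Walk.start_mem_support _, Walk.start_mem_support _⟩

theorem one_le_of_isAdmFamily {G : SimpleGraph V} {L : V ↪ ℕ} {r k : ℕ} {x : V}
    (hk : ∀ F, G.IsAdmFamily L r x F → #F ≤ k) : 1 ≤ k := by
  refine hk {⟨x, Path.nil⟩} ⟨?_, ?_⟩
  · intro P hP
    obtain rfl := Finset.mem_singleton.1 hP
    simp
  · intro P hP Q hQ hne
    exact absurd ((Finset.mem_singleton.1 hP).trans (Finset.mem_singleton.1 hQ).symm) hne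

/-- In an order of admissibility at most `k`, at most `k ^ s` smaller vertices are strongly
`s`-reachable from a given vertex. -/
theorem card_strongReach_le [Fintype V] {G : SimpleGraph V} {L : V ↪ ℕ} {r k : ℕ}
    (hk : ∀ x F, G.IsAdmFamily L r x F → #F ≤ k) (x : V) {s : ℕ} (hs : s ≤ r) :
    #{t | L t < L x ∧ G.StrongReach L x s t} ≤ k ^ s := by
  obtain ⟨d, par, hd, hpar⟩ := G.exists_bfs L x
  have hk1 : 1 ≤ k := one_le_of_isAdmFamily (hk x)
  have hwalk : ∀ i t, G.StrongReach L x (d t) t → i ≤ d t →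
      d (par^[i] t) + i = d t ∧ G.StrongReach L x (d (par^[i] t)) (par^[i] t) ∧
      ∃ p : G.Walk (par^[i] t) t, p.length = i ∧
        ∀ z ∈ p.support, ∃ j, par^[j] z = par^[i] t ∧ d z = d (par^[i] t) + j := by
    intro i
    induction i with
    | zero => exact fun t ht _ => ⟨rfl, ht, Walk.nil, rfl, fun z hz => ⟨0, by simpa using hz, by
        simp only [Function.iterate_zero, id, Walk.support_nil, List.mem_singleton] at hz ⊢
        rw [hz, add_zero]⟩⟩
    | succ i ih =>
      intro t ht hit
      obtain ⟨m, hm⟩ : ∃ m, d t = m + 1 := ⟨d t - 1, by omega⟩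
      obtain ⟨h1, h2, -, h3⟩ := hpar t m ht hm
      have h := ih (par t) (h1.symm ▸ h2) (by omega)
      rw [show par^[i] (par t) = par^[i + 1] t from rfl] at h
      obtain ⟨h4, h5, p, h6, h7⟩ := h
      refine ⟨by omega, h5, p.concat h3, (Walk.length_concat _ _).trans (by rw [h6]), fun z hz => ?_⟩
      rw [Walk.support_concat, List.mem_append] at hz
      rcases hz with hz | hz
      · exact h7 z hz
      · obtain rfl := List.mem_singleton.1 hz
        exact ⟨i + 1, rfl, by omega⟩
  -- The tree descendants of `u`, at most `j` levels down, that lie below `x` in the order.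
  let Des : ℕ → V → Finset V := fun j u => {t | L t < L x ∧ G.StrongReach L x (d t) t ∧
    ∃ i ≤ j, par^[i] t = u ∧ d t = d u + i}
  have hmem : ∀ j u t, t ∈ Des j u ↔ L t < L x ∧ G.StrongReach L x (d t) t ∧
      ∃ i ≤ j, par^[i] t = u ∧ d t = d u + i := fun j u t => by simp [Des]
  have hDes : ∀ j u, d u + j ≤ r → #(Des j u) ≤ k ^ j := by
    intro j
    induction j with
    | zero =>
      intro u _
      rw [pow_zero]
      refine Finset.card_le_one.2 fun t ht t' ht' => ?_
      obtain ⟨-, -, i, hi, h1, -⟩ := (hmem _ _ _).1 ht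
      obtain ⟨-, -, i', hi', h1', -⟩ := (hmem _ _ _).1 ht'
      obtain rfl := Nat.le_zero.1 hi
      obtain rfl := Nat.le_zero.1 hi'
      exact h1.trans h1'.symm
    | succ j ih =>
      intro u huj
      have hstep : ∀ t ∈ Des (j + 1) u, t = u ∨ ∃ c, par c = u ∧ d c = d u + 1 ∧
          t ∈ Des j c ∧ G.StrongReach L x (d c) c := by
        intro t ht
        obtain ⟨h1, h2, i, hi, h3, h4⟩ := (hmem _ _ _).1 ht
        cases i with
        | zero => exact Or.inl h3
        | succ i =>
          rw [Function.iterate_succ_apply'] at h3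
          obtain ⟨h5, h6, -⟩ := hwalk i t h2 (by omega)
          exact Or.inr ⟨par^[i] t, h3, by omega, (hmem _ _ _).2
            ⟨h1, h2, i, by omega, rfl, by omega⟩, h6⟩
      -- A parent is never below `x`, so a vertex `u` below `x` is a leaf. Otherwise, one tree path
      -- through each relevant child gives an admissible family at `u`, since its ends satisfy `L t
      -- < L x ≤ L u`.
      by_cases hux : L u < L x
      · refine le_trans (Finset.card_le_one.2 fun t ht t' ht' => ?_) (Nat.one_le_pow _ _ hk1)
        have : ∀ t ∈ Des (j + 1) u, t = u := by
          intro t ht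
          refine (hstep t ht).resolve_right ?_
          rintro ⟨c, h1, h2, -, h3⟩
          have := (hpar c _ h3 h2).2.2.1
          rw [h1] at this
          omega
        exact (this t ht).trans (this t' ht').symm
      · set S : Finset V := {c | par c = u ∧ d c = d u + 1 ∧ (Des j c).Nonempty} with hS
        have hSmem : ∀ c, c ∈ S ↔ par c = u ∧ d c = d u + 1 ∧ (Des j c).Nonempty :=
          fun c => by simp [hS]
        have hsub : Des (j + 1) u ⊆ S.biUnion (Des j) := by
          intro t ht
          rcases hstep t ht with rfl | ⟨c, h1, h2, h3, -⟩
          · exact absurd ((hmem _ _ _).1 ht).1 hux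
          · exact Finset.mem_biUnion.2 ⟨c, (hSmem c).2 ⟨h1, h2, t, h3⟩, h3⟩
        have hScard : #S ≤ k := by
          have hex : ∀ c, ∃ t, c ∈ S → t ∈ Des j c := fun c => by
            by_cases hc : c ∈ S
            · obtain ⟨t, ht⟩ := ((hSmem c).1 hc).2.2
              exact ⟨t, fun _ => ht⟩
            · exact ⟨x, fun h => absurd h hc⟩
          choose t ht using hex
          refine card_le_of_isAdmFamily (hk u) S t
            -- The subtree below `c`. The level condition fixes `i`, which makes the subtrees of
            -- distinct siblings disjoint.
            (fun c => {z | ∃ i, par^[i] z = c ∧ d z = d c + i}) ?_ ?_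
          · intro c hc c' hc' hne
            rw [Set.disjoint_left]
            rintro z ⟨i, h1, h2⟩ ⟨i', h1', h2'⟩
            have h3 := ((hSmem c).1 hc).2.1
            have h3' := ((hSmem c').1 hc').2.1
            obtain rfl : i = i' := by omega
            exact hne (h1.symm.trans h1')
          · intro c hc
            obtain ⟨h1, h2, i, hi, h3, h4⟩ := (hmem _ _ _).1 (ht c hc)
            obtain ⟨h5, h6, -⟩ := (hSmem c).1 hc
            have hw := hwalk i (t c) h2 (by omega)
            rw [h3] at hw
            obtain ⟨-, h7, p, h8, h9⟩ := hw
            obtain ⟨-, -, -, h10⟩ := hpar c _ h7 h6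
            rw [h5] at h10
            refine ⟨?_, by omega, ?_⟩
            · intro h
              rw [h] at h1
              exact hux h1
            · refine ⟨Walk.cons h10 p, by rw [Walk.length_cons]; omega, fun z hz => ?_⟩
              rw [Walk.support_cons, List.mem_cons] at hz
              exact hz.imp_right (h9 z)
        calc #(Des (j + 1) u) ≤ #(S.biUnion (Des j)) := Finset.card_le_card hsub
          _ ≤ #S * k ^ j := Finset.card_biUnion_le_card_mul _ _ _ fun c hc =>
              ih c (by rw [((hSmem c).1 hc).2.1]; omega)
          _ ≤ k * k ^ j := Nat.mul_le_mul_right _ hScard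
          _ = k ^ (j + 1) := by ring
  have hx0 : G.StrongReach L x 0 x := rfl
  have hdx : d x = 0 := Nat.le_zero.1 (hd 0 x hx0).1
  refine (Finset.card_le_card ?_).trans (hDes s x (by omega))
  intro t ht
  rw [Finset.mem_filter] at ht
  obtain ⟨-, h1, h2⟩ := ht
  obtain ⟨h3, h4⟩ := hd s t h2
  obtain ⟨h5, h6, -⟩ := hwalk (d t) t h4 le_rfl
  have h7 : d (par^[d t] t) = 0 := by omega
  rw [h7] at h6
  exact (hmem _ _ _).2 ⟨h1, h4, d t, h3, h6, by omega⟩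

/-- Here `n` counts the steps already made from `x` to `z`. The remaining walk `q` starts at the
first vertex below `x`. -/
theorem Walk.exists_first_lt {G : SimpleGraph V} {L : V ↪ ℕ} {x z y : V} (p : G.Walk z y) {n : ℕ}
    (hz : G.StrongReach L x n z) (hxz : L x ≤ L z) (hy : L y < L x) :
    ∃ s t, n < s ∧ L t < L x ∧ G.StrongReach L x s t ∧
      ∃ q : G.Walk t y, s + q.length = n + p.length ∧ ∀ w ∈ q.support, w ∈ p.support := by
  induction p generalizing n with
  | nil => omega
  | @cons a c y hac p ih =>
    have hc : G.StrongReach L x (n + 1) c := ⟨a, hz, hxz, hac⟩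
    by_cases hcx : L c < L x
    · exact ⟨n + 1, c, by omega, hcx, hc, p, by simp only [Walk.length_cons]; omega,
        fun w hw => by simp [hw]⟩
    · obtain ⟨s, t, h1, h2, h3, q, h4, h5⟩ := ih hc (not_lt.1 hcx) hy
      exact ⟨s, t, by omega, h2, h3, q, by simp only [Walk.length_cons]; omega,
        fun w hw => by simp [h5 w hw]⟩

theorem card_walkReach_le [Fintype V] {G : SimpleGraph V} {L : V ↪ ℕ} {r k : ℕ}
    (hk : ∀ x F, G.IsAdmFamily L r x F → #F ≤ k) (n : ℕ) (hn : n ≤ r) (x : V) :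
    #{y | ∃ p : G.Walk x y, p.length ≤ n ∧ ∀ w ∈ p.support, L y ≤ L w} ≤ (2 * k) ^ n := by
  induction n using Nat.strong_induction_on generalizing x with
  | _ n ih =>
  have hk1 : 1 ≤ k := one_le_of_isAdmFamily (hk x)
  have hsub : ({y | ∃ p : G.Walk x y, p.length ≤ n ∧ ∀ w ∈ p.support, L y ≤ L w} : Finset V) ⊆
      insert x ((Finset.range n).biUnion fun i =>
        ({t | L t < L x ∧ G.StrongReach L x (i + 1) t} : Finset V).biUnion fun t =>
          {y | ∃ p : G.Walk t y, p.length ≤ n - 1 - i ∧ ∀ w ∈ p.support, L y ≤ L w}) := by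
    intro y hy
    obtain ⟨-, p, hp, hL⟩ := Finset.mem_filter.1 hy
    rcases (hL x p.start_mem_support).eq_or_lt with hyx | hyx
    · exact Finset.mem_insert.2 (Or.inl (L.injective hyx))
    · obtain ⟨s, t, h1, h2, h3, q, h4, h5⟩ :=
        p.exists_first_lt (L := L) (x := x) (n := 0) rfl le_rfl hyx
      refine Finset.mem_insert_of_mem ?_
      simp only [mem_biUnion, mem_range, mem_filter, mem_univ, true_and]
      obtain ⟨i, rfl⟩ : ∃ i, s = i + 1 := ⟨s - 1, by omega⟩
      exact ⟨i, by omega, t, ⟨h2, h3⟩, q, by omega, fun w hw => hL w (h5 w hw)⟩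
  -- The sum over the position of the first smaller vertex is `k ^ n * (2 ^ n - 1)`. The missing `k
  -- ^ n` pays for `x` itself.
  have hgeom : ∀ m : ℕ, ∑ i ∈ Finset.range m, 2 ^ (m - 1 - i) + 1 = 2 ^ m := by
    intro m
    rw [Finset.sum_range_reflect (fun i => 2 ^ i) m]
    induction m with
    | zero => rfl
    | succ m ihm => rw [Finset.sum_range_succ, pow_succ]; omega
  have hsum : ∑ i ∈ Finset.range n, k ^ (i + 1) * (2 * k) ^ (n - 1 - i) =
      k ^ n * ∑ i ∈ Finset.range n, 2 ^ (n - 1 - i) := by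
    rw [Finset.mul_sum]
    refine Finset.sum_congr rfl fun i hi => ?_
    have hi' := Finset.mem_range.1 hi
    have h : k ^ n = k ^ (i + 1) * k ^ (n - 1 - i) := by rw [← pow_add]; congr 1; omega
    rw [h, mul_pow]
    ring
  refine (Finset.card_le_card hsub).trans ((Finset.card_insert_le _ _).trans ?_)
  calc _ ≤ ∑ i ∈ Finset.range n, k ^ (i + 1) * (2 * k) ^ (n - 1 - i) + 1 := by
        refine Nat.add_le_add_right (Finset.card_biUnion_le.trans
          (Finset.sum_le_sum fun i hi => ?_)) 1
        have hi' := Finset.mem_range.1 hi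
        refine (Finset.card_biUnion_le_card_mul _ _ _ fun t _ =>
          ih (n - 1 - i) (by omega) (by omega) t).trans ?_
        exact Nat.mul_le_mul_right _ (card_strongReach_le hk x (by omega))
    _ ≤ k ^ n * ∑ i ∈ Finset.range n, 2 ^ (n - 1 - i) + k ^ n := by
        rw [hsum]
        exact Nat.add_le_add_left (Nat.one_le_pow _ _ hk1) _
    _ = (2 * k) ^ n := by rw [mul_pow, ← hgeom n]; ring

theorem wcol_le [Finite V] {G : SimpleGraph V} {L : V ↪ ℕ} {r k : ℕ}
    (hk : ∀ x F, G.IsAdmFamily L r x F → #F ≤ k) : G.wcol r ≤ (2 * k) ^ r := by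
  have := Fintype.ofFinite V
  refine (ciInf_le (OrderBot.bddBelow _) L).trans (ciSup_le' fun x => ?_)
  refine le_trans ?_ (card_walkReach_le hk r le_rfl x)
  rw [← Set.ncard_coe_finset]
  refine Set.ncard_le_ncard ?_ (Set.toFinite _)
  rintro y ⟨p, -, hp, hL⟩
  simpa using ⟨p, hp, hL⟩

theorem adm_le {G : SimpleGraph V} {L : V ↪ ℕ} {r k : ℕ}
    (hk : ∀ x F, G.IsAdmFamily L r x F → #F ≤ k) : G.adm r ≤ k := by
  refine (ciInf_le (OrderBot.bddBelow _) L).trans (ciSup_le' fun x => csSup_le' ?_)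
  rintro _ ⟨F, hF, rfl⟩
  exact hk x F hF

end

end SimpleGraph

/-- Once `r ^ ε ≥ B`, the factor `B ^ r` is at most `r ^ (ε * r)`. For the remaining `r ≤ N` it is
at most `B ^ N`. -/
theorem exists_mul_pow_self_le_rpow (B : ℝ) (hB : 1 ≤ B) {ε : ℝ} (hε : 0 < ε) :
    ∃ c : ℝ, ∀ r : ℕ, 1 ≤ r → (B * r) ^ r ≤ c * (r : ℝ) ^ ((1 + ε) * (r : ℝ)) := by
  obtain ⟨N, hN⟩ := Filter.eventually_atTop.1
    (((tendsto_rpow_atTop hε).comp tendsto_natCast_atTop_atTop).eventually_ge_atTop B)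
  refine ⟨B ^ N, fun r hr => ?_⟩
  have hr1 : (1 : ℝ) ≤ r := by exact_mod_cast hr
  have hr0 : (0 : ℝ) < r := by linarith
  have hsplit : (r : ℝ) ^ ((1 + ε) * (r : ℝ)) = ((r : ℝ) ^ ε) ^ r * (r : ℝ) ^ r := by
    rw [add_mul, one_mul, Real.rpow_add hr0, Real.rpow_natCast, Real.rpow_mul hr0.le,
      Real.rpow_natCast, mul_comm]
  rw [hsplit, mul_pow, ← mul_assoc]
  refine mul_le_mul_of_nonneg_right ?_ (by positivity)
  rcases le_total N r with h | h
  · have h1 : B ^ r ≤ ((r : ℝ) ^ ε) ^ r := pow_le_pow_left₀ (by linarith) (hN r h) r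
    exact h1.trans (le_mul_of_one_le_left (by positivity) (one_le_pow₀ hB))
  · have h1 : (1 : ℝ) ≤ ((r : ℝ) ^ ε) ^ r := one_le_pow₀ (Real.one_le_rpow hr1 hε.le)
    exact (pow_le_pow_right₀ hB h).trans (le_mul_of_one_le_right (by positivity) h1)

theorem mainTheorem2 {W : Type v} [Finite W] (H : SimpleGraph W)
    (C : ∀ V : Type u, SimpleGraph V → Prop)
    (hfin : ∀ (V : Type u) (G : SimpleGraph V), C V G → Finite V)
    (hC : ∀ (V : Type u) (G : SimpleGraph V), C V G → ¬ H.IsTopologicalMinor G) :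
    (∃ c : ℝ, ∀ (V : Type u) (G : SimpleGraph V), C V G →
      ∀ r : ℕ, 1 ≤ r → (G.adm r : ℝ) ≤ c * r) ∧
    (∀ ε : ℝ, 0 < ε → ∃ c : ℝ, ∀ (V : Type u) (G : SimpleGraph V), C V G →
      ∀ r : ℕ, 1 ≤ r → (G.wcol r : ℝ) ≤ c * (r : ℝ) ^ ((1 + ε) * (r : ℝ))) := by
  have := Fintype.ofFinite W
  set D := 2 ^ H.edgeSet.ncard * (Fintype.card W + 1) with hD
  set c := D ^ 2 * (1 + 2 * D) with hc
  have hord : ∀ (V : Type u) (G : SimpleGraph V), C V G → ∀ r : ℕ, 1 ≤ r →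
      ∃ L : V ↪ ℕ, ∀ x F, G.IsAdmFamily L r x F → F.card ≤ c * r := by
    intro V G hG r hr
    have := hfin V G hG
    exact SimpleGraph.exists_order_adm_le (hC V G hG) hD hr
  refine ⟨⟨c, fun V G hG r hr => ?_⟩, fun ε hε => ?_⟩
  · obtain ⟨L, hL⟩ := hord V G hG r hr
    exact_mod_cast SimpleGraph.adm_le hL
  · obtain ⟨a, ha⟩ := exists_mul_pow_self_le_rpow (2 * c + 1 : ℕ) (by simp) hε
    refine ⟨a, fun V G hG r hr => le_trans ?_ (ha r hr)⟩
    have := hfin V G hG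
    obtain ⟨L, hL⟩ := hord V G hG r hr
    have h1 := SimpleGraph.wcol_le hL
    have h2 : (2 * (c * r)) ^ r ≤ ((2 * c + 1) * r) ^ r := by
      refine Nat.pow_le_pow_left ?_ r
      rw [← mul_assoc]
      exact Nat.mul_le_mul_right _ (Nat.le_succ _)
    exact_mod_cast h1.trans h2
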